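/- Let $I=[0,1]$ with its Borel $\sigma$-algebra and Lebesgue measure $\lambda$. Let $0=a_0<a_1<a_2<\cdots$ be either finitely many points $a_0,\dots,a_N$ with $a_N=1$, or infinitely many points with $a_j\to 1$, and put $I_j=[a_j,a_{j+1}]$. Let $T:I\to I$ be a map such that: (A1) for every $j$, $T|_{(a_j,a_{j+1})}$ extends to a bijection $\psi_j:I_j\to I$ which is $C^2$ up to the boundary; (A2) there is $\Lambda>1$ such that $|\psi_j'(x)|\ge\Lambda$ for all $j\ge1$ and $x\in I_j$; (A3) there is $K>0$ such that $|\psi_j''(x)|/|\psi_j'(x)|^2\le K$ for all $j$ and all $x\in I_j$; (A4) $\psi_0$ is convex, $\psi_0(0)=0$, $\psi_0'(0)=1$, $\psi_0'(x)>1$ for $x\in I_0$, $x>0$, and, for some real $\beta\ge0$, $\psi_0''(x)\sim x^\beta$ as $x\to0^+$, i.e. there are constants $0<\kappa_1<\kappa_2$ with $\kappa_1<|\psi_0''(x)/x^\beta|<\kappa_2$ for all sufficiently small $x>0$. (The values of $T$ at the points $a_j$, and at $1$, are arbitrary.) Then $T$ is conservative and exact with respect to $\lambda$, and also with respect to every $\sigma$-finite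 $T$-invariant measure $\mu$ that is absolutely continuous with respect to $\lambda$ (in particular with respect to the infinite absolutely continuous invariant measure of $T$). Here $T$ is non-singular with respect to a measure $\nu$ if it is measurable and $\nu(T^{-1}A)=0$ whenever $\nu(A)=0$. It is conservative if it is non-singular and there is no measurable set $W$ of positive measure (wandering set) whose preimages $T^{-n}W$, $n\ge0$, are pairwise disjoint; it is exact if it is non-singular and every set $A$ of the tail $\sigma$-algebra $\bigcap_{n\ge0}T^{-n}\mathscr B$ ($\mathscr B$ the Borel sets) satisfies $\nu(A)=0$ or $\nu(I\setminus A)=0$. -/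

import Mathlib

open Set Filter Topology MeasureTheory

/-- The `j`-th element `I_j = [a_j, a_{j+1}]` of the partition with endpoints `a`. -/
def cell (a : ℕ → ℝ) (j : ℕ) : Set ℝ := Icc (a j) (a (j + 1))

/-- `T : [0,1] → [0,1]` is a Markov map with finitely many (`N < ∞`) or countably many (`N = ∞`)
surjective `C²` branches, an indifferent fixed point at `0` and uniform expansion on all the
branches but the one at `0`. The branches are indexed by the naturals `j < N`; `ψ j` is the branch
over `[a_j, a_{j+1}]` (only its values on that interval matter), and its derivatives are the
one-sided ones at the endpoints. The values of `T` at the endpoints `a_j`, and at `1`, are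
arbitrary. -/
structure IsIntermittentMarkovMap (T : unitInterval → unitInterval) (N : ℕ∞) (a : ℕ → ℝ)
    (ψ : ℕ → ℝ → ℝ) (β : ℝ) : Prop where
  /-- The partition: `0 = a_0 < a_1 < ⋯`. -/
  zero : a 0 = 0
  lt_succ : ∀ j : ℕ, (j : ℕ∞) < N → a j < a (j + 1)
  /-- The cells exhaust `[0,1]`: `a_N = 1` if `N` is finite, `a_j → 1` if it is infinite. -/
  isLUB : IsLUB {x : ℝ | ∃ j : ℕ, (j : ℕ∞) ≤ N ∧ a j = x} 1
  /-- The branches: `ψ j` extends `T` from the open cell, is onto `[0,1]` and `C²` up to the boundary. -/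
  eq_branch : ∀ j : ℕ, (j : ℕ∞) < N → ∀ x : unitInterval,
    (x : ℝ) ∈ Ioo (a j) (a (j + 1)) → (T x : ℝ) = ψ j x
  bijOn : ∀ j : ℕ, (j : ℕ∞) < N → BijOn (ψ j) (cell a j) (Icc 0 1)
  contDiffOn : ∀ j : ℕ, (j : ℕ∞) < N → ContDiffOn ℝ 2 (ψ j) (cell a j)
  /-- Uniform expansion on the cells with `j ≥ 1`. -/
  expanding : ∃ Λ : ℝ, 1 < Λ ∧ ∀ j : ℕ, 1 ≤ j → (j : ℕ∞) < N → ∀ x ∈ cell a j,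
    Λ ≤ |derivWithin (ψ j) (cell a j) x|
  /-- Bounded `|ψ_j''| / |ψ_j'|²`, uniformly in `j`. -/
  adler : ∃ K : ℝ, 0 < K ∧ ∀ j : ℕ, (j : ℕ∞) < N → ∀ x ∈ cell a j,
    |iteratedDerivWithin 2 (ψ j) (cell a j) x| / |derivWithin (ψ j) (cell a j) x| ^ 2 ≤ K
  /-- The branch at the indifferent fixed point `0`; `ψ_0'' ∼ x^β` as `x → 0⁺`, up to constants. -/
  convexOn : ConvexOn ℝ (cell a 0) (ψ 0)
  map_zero : ψ 0 0 = 0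
  deriv_zero : derivWithin (ψ 0) (cell a 0) 0 = 1
  one_lt_deriv : ∀ x ∈ cell a 0, 0 < x → 1 < derivWithin (ψ 0) (cell a 0) x
  beta_nonneg : 0 ≤ β
  deriv2_sim : ∃ κ₁ κ₂ : ℝ, 0 < κ₁ ∧ κ₁ < κ₂ ∧ ∀ᶠ x in 𝓝[>] (0 : ℝ),
    κ₁ < |iteratedDerivWithin 2 (ψ 0) (cell a 0) x / x ^ β| ∧
      |iteratedDerivWithin 2 (ψ 0) (cell a 0) x / x ^ β| < κ₂

/-- The tail `σ`-algebra `⋂ₙ T⁻ⁿ 𝒜` of a map `T` of a measurable space `(X, 𝒜)`. -/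
abbrev tailSigmaAlgebra {X : Type*} [m : MeasurableSpace X] (T : X → X) : MeasurableSpace X :=
  ⨅ n : ℕ, MeasurableSpace.comap T^[n] m

/-- `T` is exact with respect to `ν`: it is measurable and non-singular, and every set of its tail
`σ`-algebra is `ν`-null or has a `ν`-null complement. -/
structure IsExact {X : Type*} [MeasurableSpace X] (T : X → X) (ν : Measure X) : Prop
    extends Measure.QuasiMeasurePreserving T ν ν where
  tail_trivial : ∀ A : Set X, MeasurableSet[tailSigmaAlgebra T] A → ν A = 0 ∨ ν Aᶜ = 0

/-! The mechanism is bounded distortion of inverse branches. Prepending one branch inverse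
multiplies the distortion by at most `exp (K δ)`, where `δ` bounds the diameter of the current
image. The diameters must therefore be summable. An orbit avoiding the endpoints leaves the first
cell infinitely often, and each visit to a cell `j ≥ 1` contracts by `Λ⁻¹`. During a stay near `0`
there is no uniform contraction, but the inverse of `ψ 0` is concave, so diameters are dominated by
the telescoping differences of the backward orbit of `a 1`. This gives `exists_isInverseBranch`:
small images around every regular point, with one distortion constant.

At a density point of a non-null set `W`, such a branch shows that `T^[n] '' W` fills all but `ε` of
the interval, and the bounded derivative of `ψ 1` gives the same for `n + 1`
(`exists_volume_compl_image_le`). Hence `W` meets one of its images, which is conservativity. For a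
tail set `A`, the images of `A \ T⁻¹ A` under two consecutive iterates are disjoint, so this set is
null. Almost every orbit from `A` then stays in `A`; if `A` is non-null, its images fill the
interval and the complement of `A` is null. -/

/-! ### Distortion of `C²` maps with bounded `f'' / f'²` -/

theorem exp_distortion_of_deriv_pos {p q K δ : ℝ} {f f' f'' : ℝ → ℝ}
    (hf : ContinuousOn f (Icc p q)) (hf' : ContinuousOn f' (Icc p q))
    (h1 : ∀ x ∈ Ioo p q, HasDerivAt f (f' x) x) (h2 : ∀ x ∈ Ioo p q, HasDerivAt f' (f'' x) x)
    (hpos : ∀ x ∈ Icc p q, 0 < f' x) (hK : ∀ x ∈ Icc p q, |f'' x| ≤ K * f' x ^ 2) (hK0 : 0 ≤ K)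
    {S : Set ℝ} (hS : S ⊆ Icc p q) (hδ : ∀ x ∈ S, ∀ y ∈ S, |f x - f y| ≤ δ)
    {x y z w : ℝ} (hx : x ∈ S) (hy : y ∈ S) (hz : z ∈ S) (hw : w ∈ S) :
    |x - y| * |f z - f w| ≤ Real.exp (K * δ) * (|z - w| * |f x - f y|) := by
  wlog hxy : x < y generalizing x y
  · rcases (not_lt.1 hxy).eq_or_lt with rfl | h
    · simp
    · rw [abs_sub_comm x, abs_sub_comm (f x)]
      exact this hy hx h
  wlog hzw : z < w generalizing z w
  · rcases (not_lt.1 hzw).eq_or_lt with rfl | h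
    · simp only [sub_self, abs_zero, mul_zero, zero_mul]
      exact le_rfl
    · rw [abs_sub_comm z, abs_sub_comm (f z)]
      exact this hw hz h
  have mono : ∀ {g g' : ℝ → ℝ}, ContinuousOn g (Icc p q) →
      (∀ x ∈ Ioo p q, HasDerivAt g (g' x) x) → (∀ x ∈ Ioo p q, 0 ≤ g' x) →
      MonotoneOn g (Icc p q) := by
    intro g g' hg hd hn
    apply monotoneOn_of_deriv_nonneg (convex_Icc p q) hg
    · rw [interior_Icc]
      exact fun x hx => (hd x hx).differentiableAt.differentiableWithinAt
    · rw [interior_Icc]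
      intro x hx
      rw [(hd x hx).deriv]
      exact hn x hx
  have fmono : MonotoneOn f (Icc p q) :=
    mono hf h1 fun x hx => (hpos x (Ioo_subset_Icc_self hx)).le
  have hlog : ContinuousOn (fun x => Real.log (f' x)) (Icc p q) :=
    hf'.log fun x hx => (hpos x hx).ne'
  have key : ∀ x ∈ Icc p q, |f'' x / f' x| ≤ K * f' x := by
    intro x hx
    rw [abs_div, abs_of_pos (hpos x hx), div_le_iff₀ (hpos x hx)]
    linarith [hK x hx, sq (f' x)]
  have gmono : MonotoneOn (fun x => K * f x + Real.log (f' x)) (Icc p q) := by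
    refine mono (g' := fun x => K * f' x + f'' x / f' x) ((continuousOn_const.mul hf).add hlog) ?_ ?_
    · intro x hx
      exact ((h1 x hx).const_mul K).add ((h2 x hx).log (hpos x (Ioo_subset_Icc_self hx)).ne')
    · intro x hx
      linarith [(abs_le.1 (key x (Ioo_subset_Icc_self hx))).1]
  have gmono' : MonotoneOn (fun x => K * f x - Real.log (f' x)) (Icc p q) := by
    refine mono (g' := fun x => K * f' x - f'' x / f' x) ((continuousOn_const.mul hf).sub hlog) ?_ ?_
    · intro x hx
      exact ((h1 x hx).const_mul K).sub ((h2 x hx).log (hpos x (Ioo_subset_Icc_self hx)).ne')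
    · intro x hx
      linarith [(abs_le.1 (key x (Ioo_subset_Icc_self hx))).2]
  have mvt : ∀ {x y : ℝ}, x ∈ S → y ∈ S → x < y →
      ∃ ξ ∈ Ioo x y, ξ ∈ Icc p q ∧ f y - f x = f' ξ * (y - x) := by
    intro x y hx hy hxy
    have hsub : Icc x y ⊆ Icc p q := Icc_subset_Icc (hS hx).1 (hS hy).2
    obtain ⟨ξ, hξ, h⟩ := exists_hasDerivAt_eq_slope f f' hxy (hf.mono hsub)
      fun t ht => h1 t ⟨(hS hx).1.trans_lt ht.1, ht.2.trans_le (hS hy).2⟩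
    refine ⟨ξ, hξ, hsub (Ioo_subset_Icc_self hξ), ?_⟩
    rw [h, div_mul_cancel₀ _ (sub_pos.2 hxy).ne']
  obtain ⟨ξ, hξ, hξm, eξ⟩ := mvt hx hy hxy
  obtain ⟨η, hη, hηm, eη⟩ := mvt hz hw hzw
  -- The mean value points need not lie in `S`, but their images lie between images of points of
  -- `S`.
  have d : |f η - f ξ| ≤ δ := by
    have b1 := fmono (hS hx) hξm hξ.1.le
    have b2 := fmono hξm (hS hy) hξ.2.le
    have b3 := fmono (hS hz) hηm hη.1.le
    have b4 := fmono hηm (hS hw) hη.2.le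
    have c1 := abs_le.1 (hδ x hx w hw)
    have c2 := abs_le.1 (hδ y hy z hz)
    rw [abs_le]; constructor <;> linarith [c1.1, c2.2]
  have l : Real.log (f' η) - Real.log (f' ξ) ≤ K * δ := by
    have d1 : K * |f η - f ξ| ≤ K * δ := mul_le_mul_of_nonneg_left d hK0
    have d2 : K * (f η - f ξ) ≤ K * |f η - f ξ| := mul_le_mul_of_nonneg_left (le_abs_self _) hK0
    have d3 : K * -(f η - f ξ) ≤ K * |f η - f ξ| := mul_le_mul_of_nonneg_left (neg_le_abs _) hK0
    rcases le_total ξ η with h | h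
    · have := gmono' hξm hηm h
      simp only at this
      linarith
    · have := gmono hηm hξm h
      simp only at this
      linarith
  have e : f' η ≤ Real.exp (K * δ) * f' ξ := by
    rw [← Real.log_le_log_iff (hpos η hηm) (mul_pos (Real.exp_pos _) (hpos ξ hξm)),
      Real.log_mul (Real.exp_pos _).ne' (hpos ξ hξm).ne', Real.log_exp]
    linarith
  rw [abs_sub_comm x, abs_sub_comm z, abs_sub_comm (f x), abs_sub_comm (f z), eξ, eη, abs_mul,
    abs_mul, abs_of_pos (hpos ξ hξm), abs_of_pos (hpos η hηm)]
  calc |y - x| * (f' η * |w - z|) = f' η * (|y - x| * |w - z|) := by ring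
    _ ≤ Real.exp (K * δ) * f' ξ * (|y - x| * |w - z|) := by gcongr
    _ = _ := by ring

section ContDiffTwo

variable {p q : ℝ} {f : ℝ → ℝ}

theorem ContDiffOn.hasDerivAt_derivWithin_Icc (hf : ContDiffOn ℝ 2 f (Icc p q)) {x : ℝ}
    (hx : x ∈ Ioo p q) : HasDerivAt f (derivWithin f (Icc p q) x) x :=
  ((hf.differentiableOn (by norm_num)) x (Ioo_subset_Icc_self hx)).hasDerivWithinAt.hasDerivAt
    (Icc_mem_nhds hx.1 hx.2)

theorem ContDiffOn.continuousOn_derivWithin_Icc (hf : ContDiffOn ℝ 2 f (Icc p q)) (hpq : p < q) :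
    ContinuousOn (derivWithin f (Icc p q)) (Icc p q) :=
  hf.continuousOn_derivWithin (uniqueDiffOn_Icc hpq) (by norm_num)

theorem ContDiffOn.hasDerivAt_iteratedDerivWithin_two_Icc (hf : ContDiffOn ℝ 2 f (Icc p q))
    {x : ℝ} (hx : x ∈ Ioo p q) :
    HasDerivAt (derivWithin f (Icc p q)) (iteratedDerivWithin 2 f (Icc p q) x) x := by
  have hpq : p < q := hx.1.trans hx.2
  have h : DifferentiableOn ℝ (derivWithin f (Icc p q)) (Icc p q) :=
    (hf.derivWithin (m := 1) (uniqueDiffOn_Icc hpq) (by norm_num)).differentiableOn (by norm_num)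
  have := (h x (Ioo_subset_Icc_self hx)).hasDerivWithinAt.hasDerivAt (Icc_mem_nhds hx.1 hx.2)
  have e : iteratedDerivWithin 1 f (Icc p q) = derivWithin f (Icc p q) := by
    ext t; simp [iteratedDerivWithin_one]
  rwa [iteratedDerivWithin_succ, e]

/-- A nonvanishing derivative with `|f''| ≤ K f'²` controls the ratios of difference quotients. -/
theorem ContDiffOn.exp_distortion {K δ : ℝ} (hpq : p < q) (hf : ContDiffOn ℝ 2 f (Icc p q))
    (h0 : ∀ x ∈ Icc p q, derivWithin f (Icc p q) x ≠ 0) (hK0 : 0 ≤ K)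
    (hK : ∀ x ∈ Icc p q,
      |iteratedDerivWithin 2 f (Icc p q) x| / |derivWithin f (Icc p q) x| ^ 2 ≤ K)
    {S : Set ℝ} (hS : S ⊆ Icc p q) (hδ : ∀ x ∈ S, ∀ y ∈ S, |f x - f y| ≤ δ)
    {x y z w : ℝ} (hx : x ∈ S) (hy : y ∈ S) (hz : z ∈ S) (hw : w ∈ S) :
    |x - y| * |f z - f w| ≤ Real.exp (K * δ) * (|z - w| * |f x - f y|) := by
  have hc := hf.continuousOn_derivWithin_Icc hpq
  have hK' : ∀ x ∈ Icc p q,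
      |iteratedDerivWithin 2 f (Icc p q) x| ≤ K * derivWithin f (Icc p q) x ^ 2 := by
    intro x hx
    have := hK x hx
    rwa [sq_abs, div_le_iff₀ (by have := h0 x hx; positivity)] at this
  by_cases hp : ∀ x ∈ Icc p q, 0 < derivWithin f (Icc p q) x
  · exact exp_distortion_of_deriv_pos hf.continuousOn hc
      (fun x hx => hf.hasDerivAt_derivWithin_Icc hx)
      (fun x hx => hf.hasDerivAt_iteratedDerivWithin_two_Icc hx) hp hK' hK0 hS hδ hx hy hz hw
  -- A continuous nonvanishing derivative has constant sign; here it is negative, and the first case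
  -- applies to `-f`.
  · push Not at hp
    obtain ⟨t, ht, hle⟩ := hp
    have hn : ∀ x ∈ Icc p q, 0 < -derivWithin f (Icc p q) x := by
      intro x hx
      by_contra! h
      obtain ⟨r, hr, e⟩ := isPreconnected_Icc.intermediate_value ht hx hc ⟨hle, by linarith⟩
      exact h0 r hr e
    have := exp_distortion_of_deriv_pos (f := fun x => -f x) (K := K) (δ := δ)
      (f' := fun x => -derivWithin f (Icc p q) x)
      (f'' := fun x => -iteratedDerivWithin 2 f (Icc p q) x) hf.continuousOn.neg hc.neg
      (fun x hx => (hf.hasDerivAt_derivWithin_Icc hx).neg)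
      (fun x hx => (hf.hasDerivAt_iteratedDerivWithin_two_Icc hx).neg) hn
      (fun x hx => by simpa using hK' x hx) hK0 hS
      (fun x hx y hy => by rw [neg_sub_neg, abs_sub_comm]; exact hδ x hx y hy) hx hy hz hw
    simpa only [neg_sub_neg, abs_sub_comm (f w), abs_sub_comm (f y)] using this

theorem ContDiffOn.exists_derivWithin_mul_eq_sub (hf : ContDiffOn ℝ 2 f (Icc p q)) {x y : ℝ}
    (hx : x ∈ Icc p q) (hy : y ∈ Icc p q) (hxy : x < y) :
    ∃ ξ ∈ Ioo x y, ξ ∈ Icc p q ∧ f y - f x = derivWithin f (Icc p q) ξ * (y - x) := by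
  have hsub : Icc x y ⊆ Icc p q := Icc_subset_Icc hx.1 hy.2
  obtain ⟨ξ, hξ, h⟩ := exists_hasDerivAt_eq_slope f _ hxy (hf.continuousOn.mono hsub)
    fun t ht => hf.hasDerivAt_derivWithin_Icc ⟨hx.1.trans_lt ht.1, ht.2.trans_le hy.2⟩
  refine ⟨ξ, hξ, hsub (Ioo_subset_Icc_self hξ), ?_⟩
  rw [h, div_mul_cancel₀ _ (sub_pos.2 hxy).ne']

theorem ContDiffOn.exists_abs_derivWithin_mul_eq (hf : ContDiffOn ℝ 2 f (Icc p q)) {x y : ℝ}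
    (hx : x ∈ Icc p q) (hy : y ∈ Icc p q) :
    ∃ ξ ∈ Icc p q, |f x - f y| = |derivWithin f (Icc p q) ξ| * |x - y| := by
  rcases lt_trichotomy x y with h | rfl | h
  · obtain ⟨ξ, -, hξ, e⟩ := hf.exists_derivWithin_mul_eq_sub hx hy h
    exact ⟨ξ, hξ, by rw [abs_sub_comm, e, abs_mul, abs_sub_comm x]⟩
  · exact ⟨x, hx, by simp⟩
  · obtain ⟨ξ, -, hξ, e⟩ := hf.exists_derivWithin_mul_eq_sub hy hx h
    exact ⟨ξ, hξ, by rw [e, abs_mul]⟩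

end ContDiffTwo

/-! ### Lebesgue measure under Lipschitz bounds -/

/-- Lebesgue measure on the line is one-dimensional Hausdorff measure, so no measurability of `S` is
needed. -/
theorem volume_image_le_of_abs_sub_le {f : ℝ → ℝ} {S : Set ℝ} {C : ℝ} (hC : 0 ≤ C)
    (h : ∀ x ∈ S, ∀ y ∈ S, |f x - f y| ≤ C * |x - y|) :
    volume (f '' S) ≤ ENNReal.ofReal C * volume S := by
  have hL : LipschitzOnWith C.toNNReal f S :=
    LipschitzOnWith.of_dist_le_mul fun x hx y hy => by
      simpa [Real.dist_eq, hC] using h x hx y hy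
  simpa [hausdorffMeasure_real, ENNReal.ofReal] using
    hL.hausdorffMeasure_image_le (d := 1) zero_le_one

theorem volume_le_of_abs_sub_le {f : ℝ → ℝ} {S : Set ℝ} {C : ℝ} (hC : 0 ≤ C)
    (h : ∀ x ∈ S, ∀ y ∈ S, |x - y| ≤ C * |f x - f y|) :
    volume S ≤ ENNReal.ofReal C * volume (f '' S) := by
  have hinj : InjOn f S := fun x hx y hy e => by
    have := h x hx y hy
    rw [e, sub_self, abs_zero, mul_zero] at this
    linarith [abs_eq_zero.1 (le_antisymm this (abs_nonneg _))]
  have hl := hinj.leftInvOn_invFunOn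
  have := volume_image_le_of_abs_sub_le (f := Function.invFunOn f S) (S := f '' S) hC (by
    rintro _ ⟨x, hx, rfl⟩ _ ⟨y, hy, rfl⟩
    rw [hl hx, hl hy]
    exact h x hx y hy)
  rwa [hl.image_image] at this

/-! ### Regular points and inverse branches -/

/-- The inverse `[0,1] → [a_j, a_{j+1}]` of the `j`-th branch. -/
noncomputable def invBranch (a : ℕ → ℝ) (ψ : ℕ → ℝ → ℝ) (j : ℕ) : ℝ → ℝ :=
  Function.invFunOn (ψ j) (cell a j)

/-- The points whose orbits avoid the endpoints of the partition. -/
def regularSet (T : unitInterval → unitInterval) (a : ℕ → ℝ) : Set unitInterval :=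
  {x | ∀ n, ((T^[n] x : unitInterval) : ℝ) ≠ 1 ∧ ∀ j, ((T^[n] x : unitInterval) : ℝ) ≠ a j}

theorem apply_mem_regularSet {T : unitInterval → unitInterval} {a : ℕ → ℝ} {x : unitInterval}
    (hx : x ∈ regularSet T a) : T x ∈ regularSet T a :=
  fun n => by simpa only [Function.iterate_succ_apply] using hx (n + 1)

theorem iterate_mem_regularSet {T : unitInterval → unitInterval} {a : ℕ → ℝ} {x : unitInterval}
    (hx : x ∈ regularSet T a) (n : ℕ) : T^[n] x ∈ regularSet T a :=
  fun k => by simpa only [Function.iterate_add_apply] using hx (k + n)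

/-- `f` is an inverse branch of `T^[n]` with distortion at most `exp c`. -/
structure IsInverseBranch (T : unitInterval → unitInterval) (a : ℕ → ℝ) (f : ℝ → ℝ) (n : ℕ)
    (c : ℝ) : Prop where
  mapsTo : MapsTo f (Icc 0 1) (Icc 0 1)
  injOn : InjOn f (Icc 0 1)
  distortion : ∀ u ∈ Icc (0 : ℝ) 1, ∀ v ∈ Icc (0 : ℝ) 1, ∀ s ∈ Icc (0 : ℝ) 1,
    ∀ t ∈ Icc (0 : ℝ) 1, |f u - f v| * |s - t| ≤ Real.exp c * (|f s - f t| * |u - v|)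
  iterate_eq : ∀ y ∈ regularSet T a, ∀ u ∈ Icc (0 : ℝ) 1, f u = y → (T^[n] y : ℝ) = u

theorem IsInverseBranch.id (T : unitInterval → unitInterval) (a : ℕ → ℝ) :
    IsInverseBranch T a id 0 0 where
  mapsTo := mapsTo_id _
  injOn := injOn_id _
  distortion u _ v _ s _ t _ := by simp [mul_comm]
  iterate_eq y _ u _ h := h.symm

theorem IsInverseBranch.mono {T : unitInterval → unitInterval} {a : ℕ → ℝ} {f : ℝ → ℝ} {n : ℕ}
    {c c' : ℝ} (hf : IsInverseBranch T a f n c) (h : c ≤ c') : IsInverseBranch T a f n c' where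
  mapsTo := hf.mapsTo
  injOn := hf.injOn
  distortion u hu v hv s hs t ht := (hf.distortion u hu v hv s hs t ht).trans <| by gcongr
  iterate_eq := hf.iterate_eq

theorem ConcaveOn.sub_mul_sub_le {s : Set ℝ} {f : ℝ → ℝ} (hf : ConcaveOn ℝ s f) {p q x y : ℝ}
    (hp : p ∈ s) (hy : y ∈ s) (hpq : p < q) (hqx : q ≤ x) (hxy : x < y) :
    (f y - f x) * (q - p) ≤ (f q - f p) * (y - x) := by
  have hq : q ∈ s := hf.1.ordConnected.out hp hy ⟨hpq.le, hqx.trans hxy.le⟩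
  have hx : x ∈ s := hf.1.ordConnected.out hp hy ⟨hpq.le.trans hqx, hxy.le⟩
  have h : (f y - f x) / (y - x) ≤ (f q - f p) / (q - p) := by
    rcases hqx.eq_or_lt with rfl | hqx
    · exact hf.slope_anti_adjacent hp hy hpq hxy
    · exact (hf.slope_anti_adjacent hq hy hqx hxy).trans (hf.slope_anti_adjacent hp hx hpq hqx)
  rwa [div_le_div_iff₀ (sub_pos.2 hxy) (sub_pos.2 hpq)] at h

namespace IsIntermittentMarkovMap

variable {T : unitInterval → unitInterval} {N : ℕ∞} {a : ℕ → ℝ} {ψ : ℕ → ℝ → ℝ} {β : ℝ}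
  {j : ℕ}

theorem le_one (hT : IsIntermittentMarkovMap T N a ψ β) (hj : (j : ℕ∞) ≤ N) : a j ≤ 1 :=
  hT.isLUB.1 ⟨j, hj, rfl⟩

theorem monotone_endpoints (hT : IsIntermittentMarkovMap T N a ψ β) {i : ℕ} (hij : i ≤ j)
    (hj : (j : ℕ∞) ≤ N) : a i ≤ a j := by
  induction j, hij using Nat.le_induction with
  | base => exact le_rfl
  | succ k _ ih =>
    have hk : (k : ℕ∞) < N := lt_of_lt_of_le (by exact_mod_cast Nat.lt_succ_self k) hj
    exact (ih hk.le).trans (hT.lt_succ k hk).le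

theorem succ_le (hj : (j : ℕ∞) < N) : ((j + 1 : ℕ) : ℕ∞) ≤ N := by
  push_cast
  exact Order.add_one_le_of_lt hj

theorem cell_subset (hT : IsIntermittentMarkovMap T N a ψ β) (hj : (j : ℕ∞) < N) :
    cell a j ⊆ Icc 0 1 :=
  Icc_subset_Icc (hT.zero ▸ hT.monotone_endpoints (Nat.zero_le j) hj.le) (hT.le_one (succ_le hj))

theorem cell_subset_of_pos (hT : IsIntermittentMarkovMap T N a ψ β) (hj : (j : ℕ∞) < N)
    (h : 1 ≤ j) : cell a j ⊆ Icc (a 1) 1 :=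
  Icc_subset_Icc (hT.monotone_endpoints h hj.le) (hT.le_one (succ_le hj))

theorem pos (hT : IsIntermittentMarkovMap T N a ψ β) : 0 < N := by
  rcases eq_zero_or_pos N with rfl | h
  · have : (1 : ℝ) ≤ 0 := hT.isLUB.2 (by
      rintro x ⟨j, hj, rfl⟩
      have : j = 0 := by simpa using hj
      rw [this, hT.zero])
    norm_num at this
  · exact h

theorem cell_zero (hT : IsIntermittentMarkovMap T N a ψ β) : cell a 0 = Icc 0 (a 1) := by
  rw [cell, hT.zero]

theorem zero_lt_endpoint (hT : IsIntermittentMarkovMap T N a ψ β) : 0 < a 1 := by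
  simpa [hT.zero] using hT.lt_succ 0 (by exact_mod_cast hT.pos)

theorem one_le_abs_deriv (hT : IsIntermittentMarkovMap T N a ψ β) (hj : (j : ℕ∞) < N) :
    ∀ x ∈ cell a j, 1 ≤ |derivWithin (ψ j) (cell a j) x| := by
  intro x hx
  rcases Nat.eq_zero_or_pos j with rfl | h
  · rcases (hT.cell_subset hj hx).1.eq_or_lt with rfl | h0
    · rw [hT.deriv_zero, abs_one]
    · exact (hT.one_lt_deriv x hx h0).le.trans (le_abs_self _)
  · obtain ⟨Λ, h1, hΛ⟩ := hT.expanding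
    exact h1.le.trans (hΛ j h hj x hx)

theorem mul_abs_sub_le (hT : IsIntermittentMarkovMap T N a ψ β) (hj : (j : ℕ∞) < N) {Λ : ℝ}
    (hΛ : ∀ x ∈ cell a j, Λ ≤ |derivWithin (ψ j) (cell a j) x|) {x y : ℝ} (hx : x ∈ cell a j)
    (hy : y ∈ cell a j) : Λ * |x - y| ≤ |ψ j x - ψ j y| := by
  obtain ⟨ξ, hξ, e⟩ := (hT.contDiffOn j hj).exists_abs_derivWithin_mul_eq hx hy
  rw [e]
  exact mul_le_mul_of_nonneg_right (hΛ ξ hξ) (abs_nonneg _)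

theorem abs_sub_le (hT : IsIntermittentMarkovMap T N a ψ β) (hj : (j : ℕ∞) < N) {x y : ℝ}
    (hx : x ∈ cell a j) (hy : y ∈ cell a j) : |x - y| ≤ |ψ j x - ψ j y| := by
  simpa using hT.mul_abs_sub_le hj (hT.one_le_abs_deriv hj) hx hy

theorem invBranch_mem (hT : IsIntermittentMarkovMap T N a ψ β) (hj : (j : ℕ∞) < N) {u : ℝ}
    (hu : u ∈ Icc (0 : ℝ) 1) : invBranch a ψ j u ∈ cell a j :=
  Function.invFunOn_mem ((hT.bijOn j hj).surjOn hu)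

theorem apply_invBranch (hT : IsIntermittentMarkovMap T N a ψ β) (hj : (j : ℕ∞) < N) {u : ℝ}
    (hu : u ∈ Icc (0 : ℝ) 1) : ψ j (invBranch a ψ j u) = u :=
  Function.invFunOn_eq ((hT.bijOn j hj).surjOn hu)

theorem invBranch_apply (hT : IsIntermittentMarkovMap T N a ψ β) (hj : (j : ℕ∞) < N) {x : ℝ}
    (hx : x ∈ cell a j) : invBranch a ψ j (ψ j x) = x :=
  (hT.bijOn j hj).injOn.leftInvOn_invFunOn hx

theorem invBranch_mem_Icc (hT : IsIntermittentMarkovMap T N a ψ β) (hj : (j : ℕ∞) < N) {u : ℝ}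
    (hu : u ∈ Icc (0 : ℝ) 1) : invBranch a ψ j u ∈ Icc (0 : ℝ) 1 :=
  hT.cell_subset hj (hT.invBranch_mem hj hu)

theorem invBranch_injOn (hT : IsIntermittentMarkovMap T N a ψ β) (hj : (j : ℕ∞) < N) :
    InjOn (invBranch a ψ j) (Icc 0 1) := fun u hu v hv e => by
  rw [← hT.apply_invBranch hj hu, e, hT.apply_invBranch hj hv]

theorem abs_invBranch_sub_le (hT : IsIntermittentMarkovMap T N a ψ β) (hj : (j : ℕ∞) < N)
    {u v : ℝ} (hu : u ∈ Icc (0 : ℝ) 1) (hv : v ∈ Icc (0 : ℝ) 1) :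
    |invBranch a ψ j u - invBranch a ψ j v| ≤ |u - v| := by
  simpa only [hT.apply_invBranch hj hu, hT.apply_invBranch hj hv] using
    hT.abs_sub_le hj (hT.invBranch_mem hj hu) (hT.invBranch_mem hj hv)

theorem invBranch_eq_of_mem (hT : IsIntermittentMarkovMap T N a ψ β) (hj : (j : ℕ∞) < N)
    {x : unitInterval} (hx : (x : ℝ) ∈ Ioo (a j) (a (j + 1))) : invBranch a ψ j (T x) = x := by
  rw [hT.eq_branch j hj x hx, hT.invBranch_apply hj (Ioo_subset_Icc_self hx)]

theorem apply_eq_of_invBranch_eq (hT : IsIntermittentMarkovMap T N a ψ β) (hj : (j : ℕ∞) < N)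
    {x : unitInterval} (hx : ∀ i, (x : ℝ) ≠ a i) {u : ℝ} (hu : u ∈ Icc (0 : ℝ) 1)
    (h : invBranch a ψ j u = x) : (T x : ℝ) = u := by
  have hm := hT.invBranch_mem hj hu
  rw [hT.eq_branch j hj x, ← h, hT.apply_invBranch hj hu]
  rw [h] at hm
  exact ⟨lt_of_le_of_ne hm.1 (hx j).symm, lt_of_le_of_ne hm.2 (hx (j + 1))⟩

theorem exists_mem_cell (hT : IsIntermittentMarkovMap T N a ψ β) {x : unitInterval}
    (h1 : (x : ℝ) ≠ 1) (hx : ∀ i, (x : ℝ) ≠ a i) :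
    ∃ j : ℕ, (j : ℕ∞) < N ∧ (x : ℝ) ∈ Ioo (a j) (a (j + 1)) := by
  classical
  have hlt : (x : ℝ) < 1 := lt_of_le_of_ne x.2.2 h1
  have hex : ∃ j : ℕ, (j : ℕ∞) ≤ N ∧ (x : ℝ) < a j := by
    obtain ⟨_, ⟨j, hj, rfl⟩, h⟩ := (lt_isLUB_iff hT.isLUB).1 hlt
    exact ⟨j, hj, h⟩
  -- The first endpoint beyond `x` is the right end of its cell.
  obtain ⟨hm, hxm⟩ := Nat.find_spec hex
  have hmin := fun i => Nat.find_min hex (m := i)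
  generalize Nat.find hex = m at hm hxm hmin
  cases m with
  | zero => rw [hT.zero] at hxm; exact absurd x.2.1 (not_le.2 hxm)
  | succ i =>
    have hi : (i : ℕ∞) < N := lt_of_lt_of_le (by exact_mod_cast Nat.lt_succ_self i) hm
    refine ⟨i, hi, lt_of_le_of_ne (not_lt.1 fun h => hmin i (Nat.lt_succ_self i) ⟨hi.le, h⟩)
      (hx i).symm, hxm⟩

/-! ### The branch at the indifferent fixed point -/

theorem sub_le_sub_zero (hT : IsIntermittentMarkovMap T N a ψ β) {x y : ℝ} (hx : x ∈ cell a 0)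
    (hy : y ∈ cell a 0) (hxy : x < y) : y - x < ψ 0 y - ψ 0 x := by
  obtain ⟨ξ, hξ, hm, e⟩ :=
    (hT.contDiffOn 0 (by exact_mod_cast hT.pos)).exists_derivWithin_mul_eq_sub hx hy hxy
  have h0 : 0 < ξ := (hT.cell_zero ▸ hx).1.trans_lt hξ.1
  have := hT.one_lt_deriv ξ hm h0
  have e' : ψ 0 y - ψ 0 x = derivWithin (ψ 0) (cell a 0) ξ * (y - x) := e
  rw [e']
  nlinarith

theorem strictMonoOn_zero (hT : IsIntermittentMarkovMap T N a ψ β) :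
    StrictMonoOn (ψ 0) (cell a 0) := fun x hx y hy hxy => by
  linarith [hT.sub_le_sub_zero hx hy hxy]

theorem lt_apply_zero (hT : IsIntermittentMarkovMap T N a ψ β) {x : ℝ} (hx : x ∈ cell a 0)
    (h0 : 0 < x) : x < ψ 0 x := by
  have hz : (0 : ℝ) ∈ cell a 0 := by
    rw [hT.cell_zero]; exact ⟨le_rfl, hT.zero_lt_endpoint.le⟩
  linarith [hT.sub_le_sub_zero hz hx h0, hT.map_zero]

theorem endpoint_mem_cell_zero (hT : IsIntermittentMarkovMap T N a ψ β) : a 1 ∈ cell a 0 := by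
  rw [hT.cell_zero]; exact ⟨hT.zero_lt_endpoint.le, le_rfl⟩

theorem endpoint_lt_one (hT : IsIntermittentMarkovMap T N a ψ β) : a 1 < 1 :=
  (hT.lt_apply_zero hT.endpoint_mem_cell_zero hT.zero_lt_endpoint).trans_le
    ((hT.bijOn 0 (by exact_mod_cast hT.pos)).mapsTo hT.endpoint_mem_cell_zero).2

theorem endpoint_mem_Icc (hT : IsIntermittentMarkovMap T N a ψ β) : a 1 ∈ Icc (0 : ℝ) 1 :=
  ⟨hT.zero_lt_endpoint.le, hT.endpoint_lt_one.le⟩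

/-- Since `a 1 < ψ 0 (a 1) ≤ 1`, the first cell cannot exhaust the interval. -/
theorem one_lt (hT : IsIntermittentMarkovMap T N a ψ β) : ((1 : ℕ) : ℕ∞) < N := by
  by_contra! h
  have : (1 : ℝ) ≤ a 1 := hT.isLUB.2 (by
    rintro x ⟨j, hj, rfl⟩
    have hj1 : j ≤ 1 := by exact_mod_cast hj.trans h
    interval_cases j
    · rw [hT.zero]; exact hT.zero_lt_endpoint.le
    · exact le_rfl)
  exact absurd hT.endpoint_lt_one (not_lt.2 this)

theorem invBranch_zero_monotoneOn (hT : IsIntermittentMarkovMap T N a ψ β) :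
    MonotoneOn (invBranch a ψ 0) (Icc 0 1) := by
  intro u hu v hv huv
  have hp : ((0 : ℕ) : ℕ∞) < N := by exact_mod_cast hT.pos
  rw [← hT.strictMonoOn_zero.le_iff_le (hT.invBranch_mem hp hu) (hT.invBranch_mem hp hv),
    hT.apply_invBranch hp hu, hT.apply_invBranch hp hv]
  exact huv

theorem invBranch_zero_lt (hT : IsIntermittentMarkovMap T N a ψ β) {u : ℝ} (hu : u ∈ Icc (0 : ℝ) 1)
    (h0 : 0 < u) : invBranch a ψ 0 u < u := by
  have hp : ((0 : ℕ) : ℕ∞) < N := by exact_mod_cast hT.pos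
  have hm := hT.invBranch_mem hp hu
  rcases (hT.cell_subset hp hm).1.eq_or_lt with h | h
  · rwa [← h]
  · simpa only [hT.apply_invBranch hp hu] using hT.lt_apply_zero hm h

theorem iterate_invBranch_zero_mapsTo (hT : IsIntermittentMarkovMap T N a ψ β) (k : ℕ) :
    MapsTo (invBranch a ψ 0)^[k] (Icc 0 1) (Icc 0 1) :=
  MapsTo.iterate (fun _ hu => hT.invBranch_mem_Icc (by exact_mod_cast hT.pos) hu) k

theorem abs_iterate_invBranch_zero_sub_le (hT : IsIntermittentMarkovMap T N a ψ β) (k : ℕ)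
    {u v : ℝ} (hu : u ∈ Icc (0 : ℝ) 1) (hv : v ∈ Icc (0 : ℝ) 1) :
    |(invBranch a ψ 0)^[k] u - (invBranch a ψ 0)^[k] v| ≤ |u - v| := by
  induction k with
  | zero => exact le_rfl
  | succ k ih =>
    simp only [Function.iterate_succ_apply']
    exact (hT.abs_invBranch_sub_le (by exact_mod_cast hT.pos)
      (hT.iterate_invBranch_zero_mapsTo k hu) (hT.iterate_invBranch_zero_mapsTo k hv)).trans ih

theorem invBranch_zero_concaveOn (hT : IsIntermittentMarkovMap T N a ψ β) :
    ConcaveOn ℝ (Icc 0 1) (invBranch a ψ 0) := by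
  have hp : ((0 : ℕ) : ℕ∞) < N := by exact_mod_cast hT.pos
  refine ⟨convex_Icc 0 1, fun u hu v hv s t hs ht hst => ?_⟩
  have hw := convex_Icc (0 : ℝ) 1 hu hv hs ht hst
  have hc := hT.convexOn.2 (hT.invBranch_mem hp hu) (hT.invBranch_mem hp hv) hs ht hst
  rw [hT.apply_invBranch hp hu, hT.apply_invBranch hp hv, ← hT.apply_invBranch hp hw] at hc
  exact (hT.strictMonoOn_zero.le_iff_le (hT.convexOn.1 (hT.invBranch_mem hp hu)
    (hT.invBranch_mem hp hv) hs ht hst) (hT.invBranch_mem hp hw)).1 hc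

/-- Concavity survives composition only together with monotonicity, so the two are carried through
the induction jointly. -/
theorem iterate_invBranch_zero_concaveOn (hT : IsIntermittentMarkovMap T N a ψ β) (k : ℕ) :
    MonotoneOn (invBranch a ψ 0)^[k] (Icc 0 1) ∧
      ConcaveOn ℝ (Icc 0 1) (invBranch a ψ 0)^[k] := by
  induction k with
  | zero => exact ⟨monotoneOn_id, concaveOn_id (convex_Icc 0 1)⟩
  | succ k ih =>
    have hm := hT.iterate_invBranch_zero_mapsTo k
    rw [Function.iterate_succ']
    refine ⟨hT.invBranch_zero_monotoneOn.comp ih.1 hm, convex_Icc 0 1,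
      fun u hu v hv s t hs ht hst => ?_⟩
    have h1 := hT.invBranch_zero_concaveOn.2 (hm hu) (hm hv) hs ht hst
    have h2 := hT.invBranch_zero_monotoneOn (convex_Icc (0 : ℝ) 1 (hm hu) (hm hv) hs ht hst)
      (hm (convex_Icc (0 : ℝ) 1 hu hv hs ht hst)) (ih.2.2 hu hv hs ht hst)
    exact h1.trans h2

/-- Away from the fixed point, the iterates of the inverse branch at `0` contract summably. -/
theorem abs_iterate_invBranch_zero_sub_mul_le (hT : IsIntermittentMarkovMap T N a ψ β) (k : ℕ)
    {x y : ℝ} (hx : x ∈ Icc (a 1) 1) (hy : y ∈ Icc (a 1) 1) :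
    |(invBranch a ψ 0)^[k] x - (invBranch a ψ 0)^[k] y| * (a 1 - invBranch a ψ 0 (a 1)) ≤
      ((invBranch a ψ 0)^[k] (a 1) - (invBranch a ψ 0)^[k + 1] (a 1)) * |x - y| := by
  wlog hxy : y < x generalizing x y
  · rcases (not_lt.1 hxy).eq_or_lt with rfl | h
    · simp
    · rw [abs_sub_comm x, abs_sub_comm ((invBranch a ψ 0)^[k] x)]
      exact this hy hx h
  have hI : Icc (a 1) 1 ⊆ Icc 0 1 := Icc_subset_Icc_left hT.zero_lt_endpoint.le
  obtain ⟨hm, hc⟩ := hT.iterate_invBranch_zero_concaveOn k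
  rw [abs_of_pos (sub_pos.2 hxy), abs_of_nonneg (sub_nonneg.2 (hm (hI hy) (hI hx) hxy.le)),
    Function.iterate_succ_apply]
  -- The slope over `[y, x]` is at most the slope over the interval from `invBranch a ψ 0 (a 1)` to
  -- `a 1`, which lies to its left.
  exact hc.sub_mul_sub_le (hT.invBranch_mem_Icc (by exact_mod_cast hT.pos) hT.endpoint_mem_Icc)
    (hI hx) (hT.invBranch_zero_lt hT.endpoint_mem_Icc hT.zero_lt_endpoint) hy.1 hxy

/-! ### Distortion of the inverse branches of the iterates -/

/-- Distortion exponents add. The new factor is governed by the diameter `δ` of the image of `f`,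
because `ψ j` maps the new image back onto it. -/
theorem isInverseBranch_comp (hT : IsIntermittentMarkovMap T N a ψ β) {K : ℝ} (hK0 : 0 ≤ K)
    (hK : ∀ j : ℕ, (j : ℕ∞) < N → ∀ x ∈ cell a j,
      |iteratedDerivWithin 2 (ψ j) (cell a j) x| / |derivWithin (ψ j) (cell a j) x| ^ 2 ≤ K)
    (hj : (j : ℕ∞) < N) {f : ℝ → ℝ} {n : ℕ} {c δ : ℝ} (hf : IsInverseBranch T a f n c)
    (hδ : ∀ u ∈ Icc (0 : ℝ) 1, ∀ v ∈ Icc (0 : ℝ) 1, |f u - f v| ≤ δ) :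
    IsInverseBranch T a (invBranch a ψ j ∘ f) (n + 1) (c + K * δ) where
  mapsTo _ hu := hT.invBranch_mem_Icc hj (hf.mapsTo hu)
  injOn := (hT.invBranch_injOn hj).comp hf.injOn hf.mapsTo
  distortion u hu v hv s hs t ht := by
    have h0 : ∀ x ∈ cell a j, derivWithin (ψ j) (cell a j) x ≠ 0 := fun x hx h => by
      have := hT.one_le_abs_deriv hj x hx
      rw [h, abs_zero] at this
      norm_num at this
    have key := ContDiffOn.exp_distortion (δ := δ) (S := (invBranch a ψ j ∘ f) '' Icc 0 1)
      (hT.lt_succ j hj) (hT.contDiffOn j hj) h0 hK0 (hK j hj)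
      (by rintro _ ⟨r, hr, rfl⟩; exact hT.invBranch_mem hj (hf.mapsTo hr))
      (by
        rintro _ ⟨r, hr, rfl⟩ _ ⟨r', hr', rfl⟩
        simp only [Function.comp_apply, hT.apply_invBranch hj (hf.mapsTo hr),
          hT.apply_invBranch hj (hf.mapsTo hr')]
        exact hδ r hr r' hr')
      (mem_image_of_mem _ hu) (mem_image_of_mem _ hv) (mem_image_of_mem _ hs)
      (mem_image_of_mem _ ht)
    simp only [Function.comp_apply, hT.apply_invBranch hj (hf.mapsTo hu),
      hT.apply_invBranch hj (hf.mapsTo hv), hT.apply_invBranch hj (hf.mapsTo hs),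
      hT.apply_invBranch hj (hf.mapsTo ht)] at key ⊢
    have hd := hf.distortion u hu v hv s hs t ht
    rcases eq_or_ne u v with rfl | huv
    · simp
    rcases eq_or_ne s t with rfl | hst
    · simp
    have p1 : 0 < |f u - f v| := abs_pos.2 (sub_ne_zero.2 fun h => huv (hf.injOn hu hv h))
    have p2 : 0 < |f s - f t| := abs_pos.2 (sub_ne_zero.2 fun h => hst (hf.injOn hs ht h))
    have hmul := mul_le_mul key hd (by positivity) (by positivity)
    rw [Real.exp_add]
    -- The product of the two distortion inequalities contains the increments of `f` on both sides;
    -- they are positive and cancel.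
    refine le_of_mul_le_mul_right ?_ (mul_pos p1 p2)
    calc _ = _ := by ring
      _ ≤ _ := hmul
      _ = _ := by ring
  iterate_eq y hy u hu h := by
    have h1 : (T y : ℝ) = f u :=
      hT.apply_eq_of_invBranch_eq hj (fun i => (hy 0).2 i) (hf.mapsTo hu) h
    rw [Function.iterate_succ_apply]
    exact hf.iterate_eq (T y) (apply_mem_regularSet hy) u hu h1.symm

/-- The diameters of the successive images telescope, so the added exponent is bounded uniformly in
the length `k` of the stay near `0`. -/
theorem isInverseBranch_iterate_zero_comp (hT : IsIntermittentMarkovMap T N a ψ β) {K : ℝ}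
    (hK0 : 0 ≤ K)
    (hK : ∀ j : ℕ, (j : ℕ∞) < N → ∀ x ∈ cell a j,
      |iteratedDerivWithin 2 (ψ j) (cell a j) x| / |derivWithin (ψ j) (cell a j) x| ^ 2 ≤ K)
    {f : ℝ → ℝ} {n : ℕ} {c δ : ℝ} (hf : IsInverseBranch T a f n c)
    (hfa : MapsTo f (Icc 0 1) (Icc (a 1) 1))
    (hδ : ∀ u ∈ Icc (0 : ℝ) 1, ∀ v ∈ Icc (0 : ℝ) 1, |f u - f v| ≤ δ) (k : ℕ) :
    IsInverseBranch T a ((invBranch a ψ 0)^[k] ∘ f) (n + k)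
      (c + K * (δ / (a 1 - invBranch a ψ 0 (a 1)) * (a 1 - (invBranch a ψ 0)^[k] (a 1)))) := by
  have hd : 0 < a 1 - invBranch a ψ 0 (a 1) :=
    sub_pos.2 (hT.invBranch_zero_lt hT.endpoint_mem_Icc hT.zero_lt_endpoint)
  induction k with
  | zero => simpa using hf
  | succ k ih =>
    have hle : (invBranch a ψ 0)^[k + 1] (a 1) ≤ (invBranch a ψ 0)^[k] (a 1) := by
      rw [Function.iterate_succ_apply]
      exact (hT.iterate_invBranch_zero_concaveOn k).1
        (hT.invBranch_mem_Icc (by exact_mod_cast hT.pos) hT.endpoint_mem_Icc) hT.endpoint_mem_Icc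
        (sub_pos.1 hd).le
    have := hT.isInverseBranch_comp hK0 hK (j := 0) (by exact_mod_cast hT.pos) ih
      (δ := δ / (a 1 - invBranch a ψ 0 (a 1)) *
        ((invBranch a ψ 0)^[k] (a 1) - (invBranch a ψ 0)^[k + 1] (a 1))) (by
        intro u hu v hv
        have h1 := hT.abs_iterate_invBranch_zero_sub_mul_le k (hfa hu) (hfa hv)
        rw [div_mul_eq_mul_div, le_div_iff₀ hd]
        refine h1.trans ?_
        rw [mul_comm δ]
        exact mul_le_mul_of_nonneg_left (hδ u hu v hv) (sub_nonneg.2 hle))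
    rw [Function.iterate_succ', Function.comp_assoc, ← add_assoc]
    refine this.mono (le_of_eq ?_)
    rw [Function.iterate_succ', Function.comp_apply]
    ring

theorem exists_iterate_mem_cell (hT : IsIntermittentMarkovMap T N a ψ β) {x : unitInterval}
    (hx : x ∈ regularSet T a) :
    ∃ k j : ℕ, 1 ≤ j ∧ (j : ℕ∞) < N ∧ (∀ i < k, (T^[i] x : ℝ) ∈ Ioo (a 0) (a 1)) ∧
      (T^[k] x : ℝ) ∈ Ioo (a j) (a (j + 1)) := by
  classical
  have hp : ((0 : ℕ) : ℕ∞) < N := by exact_mod_cast hT.pos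
  by_cases hall : ∀ i, (T^[i] x : ℝ) ∈ Ioo (a 0) (a 1)
  · exfalso
    have hmem : ∀ i, (T^[i] x : ℝ) ∈ cell a 0 := fun i => Ioo_subset_Icc_self (hall i)
    have hx0 : 0 < (x : ℝ) := hT.zero ▸ (hall 0).1
    have hstep : ∀ i, (T^[i + 1] x : ℝ) = ψ 0 (T^[i] x) := fun i => by
      rw [Function.iterate_succ_apply']
      exact hT.eq_branch 0 hp _ (hall i)
    have hd := hT.lt_apply_zero (hmem 0) hx0
    simp only [Function.iterate_zero, id_eq] at hd
    -- The gain `ψ 0 t - t` increases with `t`, so every step gains at least as much as the first;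
    -- an orbit confined to the first cell would be unbounded.
    have hgrow : ∀ i : ℕ, (x : ℝ) + i * (ψ 0 x - x) ≤ T^[i] x := by
      intro i
      induction i with
      | zero => simp
      | succ i ih =>
        have hxi : (x : ℝ) ≤ T^[i] x := by
          nlinarith [(Nat.cast_nonneg i : (0 : ℝ) ≤ i)]
        have : (T^[i] x : ℝ) - x ≤ ψ 0 (T^[i] x) - ψ 0 x := by
          rcases hxi.eq_or_lt with h | h
          · rw [← h]; simp
          · exact (hT.sub_le_sub_zero (hmem 0) (hmem i) h).le
        rw [hstep]
        push_cast
        linarith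
    obtain ⟨i, hi⟩ := exists_nat_gt (1 / (ψ 0 x - x))
    rw [div_lt_iff₀ (sub_pos.2 hd)] at hi
    linarith [hgrow i, (T^[i] x).2.2]
  · push Not at hall
    have hk := Nat.find_spec hall
    have hmin := fun i => Nat.find_min hall (m := i)
    generalize Nat.find hall = k at hk hmin
    obtain ⟨j, hj, hm⟩ := hT.exists_mem_cell (hx k).1 (hx k).2
    refine ⟨k, j, Nat.one_le_iff_ne_zero.2 ?_, hj, fun i hi => not_not.1 (hmin i hi), hm⟩
    rintro rfl
    exact hk hm

theorem iterate_invBranch_zero_eq (hT : IsIntermittentMarkovMap T N a ψ β) {x : unitInterval}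
    (k : ℕ) (h : ∀ i < k, (T^[i] x : ℝ) ∈ Ioo (a 0) (a 1)) :
    (invBranch a ψ 0)^[k] (T^[k] x) = x := by
  induction k with
  | zero => rfl
  | succ k ih =>
    rw [Function.iterate_succ_apply, Function.iterate_succ_apply',
      hT.invBranch_eq_of_mem (by exact_mod_cast hT.pos) (h k (Nat.lt_succ_self k))]
    exact ih fun i hi => h i (hi.trans (Nat.lt_succ_self k))

/-- Around every regular point there are arbitrarily small images of inverse branches of iterates
whose distortion is uniformly bounded. -/
theorem exists_isInverseBranch (hT : IsIntermittentMarkovMap T N a ψ β) :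
    ∃ c θ : ℝ, 0 < θ ∧ θ < 1 ∧ ∀ x ∈ regularSet T a, ∀ m : ℕ, ∃ f : ℝ → ℝ, ∃ n, m ≤ n ∧
      IsInverseBranch T a f n c ∧ f (T^[n] x) = x ∧
      ∀ u ∈ Icc (0 : ℝ) 1, ∀ v ∈ Icc (0 : ℝ) 1, |f u - f v| ≤ θ ^ m := by
  obtain ⟨Λ, h1, hΛ⟩ := hT.expanding
  obtain ⟨K, hK0, hK⟩ := hT.adler
  have hΛ0 : 0 < Λ := one_pos.trans h1
  set θ := Λ⁻¹ with hθ
  have hθ0 : 0 < θ := inv_pos.2 hΛ0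
  have hθ1 : θ < 1 := inv_lt_one_of_one_lt₀ h1
  set d := a 1 - invBranch a ψ 0 (a 1) with hdd
  have hd : 0 < d := sub_pos.2 (hT.invBranch_zero_lt hT.endpoint_mem_Icc hT.zero_lt_endpoint)
  -- Stage `m` costs at most `K θ^m` for the expanding branch and `K θ^m / d` for the following stay
  -- in the first cell.
  set M := K * (1 + 1 / d) with hM
  have hM0 : 0 < M := by positivity
  have hcontr : ∀ j : ℕ, 1 ≤ j → (j : ℕ∞) < N → ∀ u ∈ Icc (0 : ℝ) 1, ∀ v ∈ Icc (0 : ℝ) 1,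
      |invBranch a ψ j u - invBranch a ψ j v| ≤ θ * |u - v| := by
    intro j hj1 hj u hu v hv
    have := hT.mul_abs_sub_le hj (hΛ j hj1 hj) (hT.invBranch_mem hj hu) (hT.invBranch_mem hj hv)
    rw [hT.apply_invBranch hj hu, hT.apply_invBranch hj hv] at this
    rwa [hθ, inv_mul_eq_div, le_div_iff₀ hΛ0, mul_comm]
  have main : ∀ m : ℕ, ∀ x ∈ regularSet T a, ∃ f : ℝ → ℝ, ∃ n, m ≤ n ∧
      IsInverseBranch T a f n (M * ∑ i ∈ Finset.range m, θ ^ i) ∧ f (T^[n] x) = x ∧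
      ∀ u ∈ Icc (0 : ℝ) 1, ∀ v ∈ Icc (0 : ℝ) 1, |f u - f v| ≤ θ ^ m := by
    intro m
    induction m with
    | zero =>
      intro x _
      refine ⟨id, 0, le_rfl, by simpa using IsInverseBranch.id T a, rfl, ?_⟩
      intro u hu v hv
      rw [pow_zero, abs_le]
      constructor <;> simp only [id] <;> linarith [hu.1, hu.2, hv.1, hv.2]
    | succ m ih =>
      intro x hx
      obtain ⟨k, j, hj1, hj, hk, hm⟩ := hT.exists_iterate_mem_cell hx
      -- The branch is built from the far end of the orbit: the one at `T^[k + 1] x` is followed by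
      -- the inverse of `ψ j`, then by `k` inverses of `ψ 0`.
      obtain ⟨g, n, hmn, hg, hgx, hgδ⟩ := ih (T^[k + 1] x) (iterate_mem_regularSet hx (k + 1))
      have hφ := hT.isInverseBranch_comp hK0.le hK hj hg hgδ
      have hφδ : ∀ u ∈ Icc (0 : ℝ) 1, ∀ v ∈ Icc (0 : ℝ) 1,
          |(invBranch a ψ j ∘ g) u - (invBranch a ψ j ∘ g) v| ≤ θ ^ (m + 1) := by
        intro u hu v hv
        rw [pow_succ']
        exact (hcontr j hj1 hj _ (hg.mapsTo hu) _ (hg.mapsTo hv)).trans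
          (mul_le_mul_of_nonneg_left (hgδ u hu v hv) hθ0.le)
      have hψ := hT.isInverseBranch_iterate_zero_comp hK0.le hK hφ
        (fun u hu => hT.cell_subset_of_pos hj hj1 (hT.invBranch_mem hj (hg.mapsTo hu))) hφδ k
      refine ⟨_, _, ?_, hψ.mono ?_, ?_, ?_⟩
      · omega
      · have hk0 : 0 ≤ (invBranch a ψ 0)^[k] (a 1) :=
          (hT.iterate_invBranch_zero_mapsTo k hT.endpoint_mem_Icc).1
        have hk1 : a 1 - (invBranch a ψ 0)^[k] (a 1) ≤ 1 := by linarith [hT.endpoint_lt_one]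
        have hpow : θ ^ (m + 1) ≤ θ ^ m := pow_le_pow_of_le_one hθ0.le hθ1.le (Nat.le_succ m)
        have : θ ^ (m + 1) / d * (a 1 - (invBranch a ψ 0)^[k] (a 1)) ≤ θ ^ m / d :=
          (mul_le_of_le_one_right (by positivity) hk1).trans (by gcongr)
        have := mul_le_mul_of_nonneg_left this hK0.le
        rw [Finset.sum_range_succ, mul_add, hM]
        have e : K * (1 + 1 / d) * θ ^ m = K * θ ^ m + K * (θ ^ m / d) := by ring
        rw [e]
        linarith
      · have e : T^[n + 1 + k] x = T^[n] (T^[k + 1] x) := by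
          rw [← Function.iterate_add_apply]; congr 1; omega
        rw [e, Function.comp_apply, Function.comp_apply, hgx, Function.iterate_succ_apply',
          hT.invBranch_eq_of_mem hj hm, hT.iterate_invBranch_zero_eq k hk]
      · intro u hu v hv
        exact (hT.abs_iterate_invBranch_zero_sub_le k (hφ.mapsTo hu) (hφ.mapsTo hv)).trans
          (hφδ u hu v hv)
  refine ⟨M * (1 - θ)⁻¹, θ, hθ0, hθ1, fun x hx m => ?_⟩
  obtain ⟨f, n, hmn, hf, hfx, hfδ⟩ := main m x hx
  refine ⟨f, n, hmn, hf.mono ?_, hfx, hfδ⟩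
  gcongr
  rw [← tsum_geometric_of_lt_one hθ0.le hθ1]
  exact (summable_geometric_of_lt_one hθ0.le hθ1).sum_le_tsum _ fun i _ => by positivity

end IsIntermittentMarkovMap

/-! ### Non-singularity, density points and images of non-null sets -/

namespace IsIntermittentMarkovMap

variable {T : unitInterval → unitInterval} {N : ℕ∞} {a : ℕ → ℝ} {ψ : ℕ → ℝ → ℝ} {β : ℝ}

theorem countable_endpoints (a : ℕ → ℝ) :
    {x : unitInterval | (x : ℝ) = 1 ∨ ∃ j, (x : ℝ) = a j}.Countable := by
  have h : ({x : ℝ | x = 1 ∨ ∃ j, x = a j}).Countable := by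
    refine ((countable_singleton (1 : ℝ)).union (countable_range a)).mono ?_
    rintro x (rfl | ⟨j, rfl⟩)
    · exact Or.inl rfl
    · exact Or.inr ⟨j, rfl⟩
  exact h.preimage Subtype.val_injective

/-- The arbitrary values of `T` at endpoints only affect a countable piece; the rest is described by
the branches. Measurability and non-singularity both follow from this splitting. -/
theorem preimage_eq (hT : IsIntermittentMarkovMap T N a ψ β) (A : Set unitInterval) :
    T ⁻¹' A = {x : unitInterval | (x : ℝ) = 1 ∨ ∃ j, (x : ℝ) = a j} ∩ T ⁻¹' A ∪
      ⋃ j ∈ {j : ℕ | (j : ℕ∞) < N}, Subtype.val ⁻¹'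
        (Ioo (a j) (a (j + 1)) ∩ ψ j ⁻¹' (Subtype.val '' A)) := by
  ext x
  simp only [mem_union, mem_inter_iff, mem_preimage, mem_iUnion, mem_ofPred_eq, exists_prop]
  constructor
  · intro hx
    by_cases hE : (x : ℝ) = 1 ∨ ∃ j, (x : ℝ) = a j
    · exact Or.inl ⟨hE, hx⟩
    · push Not at hE
      obtain ⟨j, hj, hm⟩ := hT.exists_mem_cell hE.1 hE.2
      exact Or.inr ⟨j, hj, hm, T x, hx, hT.eq_branch j hj x hm⟩
  · rintro (⟨-, h⟩ | ⟨j, hj, hm, y, hy, e⟩)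
    · exact h
    · rw [← hT.eq_branch j hj x hm] at e
      rwa [← Subtype.ext e]

theorem measurable (hT : IsIntermittentMarkovMap T N a ψ β) : Measurable T := by
  intro A hA
  rw [hT.preimage_eq]
  refine ((countable_endpoints a).mono inter_subset_left).measurableSet.union
    (MeasurableSet.biUnion (to_countable _) fun j hj => measurable_subtype_coe ?_)
  have hc : Continuous ((Ioo (a j) (a (j + 1))).domRestrict (ψ j)) :=
    ((hT.contDiffOn j hj).continuousOn.mono Ioo_subset_Icc_self).domRestrict
  have hm := hc.measurable (measurableSet_Icc.subtype_image hA : MeasurableSet (Subtype.val '' A))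
  have := measurableSet_Ioo.subtype_image hm
  rwa [domRestrict_eq, preimage_comp, Subtype.image_preimage_coe] at this

theorem quasiMeasurePreserving (hT : IsIntermittentMarkovMap T N a ψ β) :
    Measure.QuasiMeasurePreserving T volume volume := by
  refine ⟨hT.measurable, Measure.AbsolutelyContinuous.mk fun A hA h0 => ?_⟩
  rw [Measure.map_apply hT.measurable hA, hT.preimage_eq]
  refine measure_union_null (((countable_endpoints a).mono inter_subset_left).measure_zero _)
    ((measure_biUnion_null_iff (to_countable _)).2 fun j hj => ?_)
  rw [unitInterval.volume_apply] at h0 ⊢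
  refine measure_mono_null (image_preimage_subset _ _) (le_antisymm ?_ zero_le)
  -- No branch shrinks distances, so its part of the preimage is no larger than `A`.
  have h := volume_le_of_abs_sub_le (f := ψ j) (C := 1) zero_le_one
    (S := Ioo (a j) (a (j + 1)) ∩ ψ j ⁻¹' (Subtype.val '' A)) fun x hx y hy => by
      rw [one_mul]
      exact hT.abs_sub_le hj (Ioo_subset_Icc_self hx.1) (Ioo_subset_Icc_self hy.1)
  rw [ENNReal.ofReal_one, one_mul] at h
  refine h.trans ((measure_mono ?_).trans h0.le)
  rintro _ ⟨x, hx, rfl⟩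
  exact hx.2

theorem ae_forall_iterate_notMem (hT : IsIntermittentMarkovMap T N a ψ β) {E : Set unitInterval}
    (hE : volume E = 0) : ∀ᵐ x, ∀ n, T^[n] x ∉ E :=
  ae_all_iff.2 fun n => measure_eq_zero_iff_ae_notMem.1
    ((hT.quasiMeasurePreserving.iterate n).preimage_null hE)

theorem ae_mem_regularSet (hT : IsIntermittentMarkovMap T N a ψ β) :
    ∀ᵐ x, x ∈ regularSet T a := by
  filter_upwards [hT.ae_forall_iterate_notMem ((countable_endpoints a).measure_zero volume)]
    with x hx n
  simpa using hx n

theorem measurableSet_regularSet (hT : IsIntermittentMarkovMap T N a ψ β) :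
    MeasurableSet (regularSet T a) := by
  have : regularSet T a =
      ⋂ n, T^[n] ⁻¹' {x : unitInterval | (x : ℝ) = 1 ∨ ∃ j, (x : ℝ) = a j}ᶜ := by
    ext x; simp [regularSet]
  rw [this]
  exact MeasurableSet.iInter fun n =>
    (hT.measurable.iterate n) (countable_endpoints a).measurableSet.compl

/-- An inverse branch around a density point of `W` with small image has almost all of its
preimages of points of `W`. -/
theorem exists_isInverseBranch_volume_le (hT : IsIntermittentMarkovMap T N a ψ β)
    {W : Set unitInterval} (hW : MeasurableSet W) (h0 : volume W ≠ 0) {ε : ℝ} (hε : 0 < ε) :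
    ∃ f : ℝ → ℝ, ∃ n c, 1 ≤ n ∧ IsInverseBranch T a f n c ∧
      volume {u ∈ Icc (0 : ℝ) 1 | f u ∉ Subtype.val '' (W ∩ regularSet T a)} ≤
        ENNReal.ofReal ε := by
  obtain ⟨c, θ, hθ0, hθ1, hbr⟩ := hT.exists_isInverseBranch
  set V : Set ℝ := Subtype.val '' (W ∩ regularSet T a) with hV
  have hVm : MeasurableSet V :=
    measurableSet_Icc.subtype_image (hW.inter hT.measurableSet_regularSet)
  have hV0 : volume V ≠ 0 := by
    rw [hV, ← unitInterval.volume_apply, measure_inter_conull (mem_ae_iff.1 ?_)]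
    · exact h0
    · exact Filter.mem_of_superset hT.ae_mem_regularSet fun x hx => hx
  obtain ⟨x, hxV, hx⟩ : ∃ x ∈ V, Tendsto
      (fun r => volume (Vᶜ ∩ Metric.closedBall x r) / volume (Metric.closedBall x r)) (𝓝[>] 0)
        (𝓝 (Vᶜ.indicator 1 x)) := by
    by_contra! h
    refine hV0 (measure_mono_null (fun x hx => ?_)
      (ae_iff.1 (Besicovitch.ae_tendsto_measure_inter_div_of_measurableSet volume hVm.compl)))
    exact h x hx
  rw [indicator_of_notMem (by simpa using hxV)] at hx
  -- Chosen so that `(exp c / d) * η * (2 * r) = ε` for the radius `r = exp c * d` below.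
  set η : ℝ := ε / (2 * Real.exp c * Real.exp c) with hη
  have hη0 : 0 < η := by positivity
  have hev := hx.eventually_lt_const (ENNReal.ofReal_pos.2 hη0)
  obtain ⟨ρ, hρ, hball⟩ := mem_nhdsGT_iff_exists_Ioo_subset.1 hev
  obtain ⟨m, hm⟩ := exists_pow_lt_of_lt_one (div_pos hρ (Real.exp_pos c)) hθ1
  obtain ⟨y, hy, rfl⟩ := hxV
  -- Using `m + 1` instead of `m` forces `n ≥ 1`.
  obtain ⟨f, n, hmn, hf, hfy, hfδ⟩ := hbr y hy.2 (m + 1)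
  refine ⟨f, n, c, by omega, hf, ?_⟩
  have i0 : (0 : ℝ) ∈ Icc (0 : ℝ) 1 := ⟨le_rfl, zero_le_one⟩
  have i1 : (1 : ℝ) ∈ Icc (0 : ℝ) 1 := ⟨zero_le_one, le_rfl⟩
  set d := |f 1 - f 0| with hd
  have hd0 : 0 < d :=
    abs_pos.2 (sub_ne_zero.2 fun h => one_ne_zero (hf.injOn i1 i0 h))
  set r := Real.exp c * d with hr
  have hr0 : 0 < r := by positivity
  have hrρ : r < ρ := by
    have h1 : d ≤ θ ^ m := (hfδ 1 i1 0 i0).trans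
      (pow_le_pow_of_le_one hθ0.le hθ1.le (Nat.le_succ m))
    have := (lt_div_iff₀ (Real.exp_pos c)).1 (h1.trans_lt hm)
    rwa [hr, mul_comm]
  have hmeas : volume (Vᶜ ∩ Metric.closedBall (y : ℝ) r) ≤ ENNReal.ofReal (η * (2 * r)) := by
    have h : volume (Vᶜ ∩ Metric.closedBall (y : ℝ) r) / volume (Metric.closedBall (y : ℝ) r) ≤
        ENNReal.ofReal η := le_of_lt (show _ from hball ⟨hr0, hrρ⟩)
    rw [Real.volume_closedBall] at h
    rw [ENNReal.ofReal_mul hη0.le]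
    exact (ENNReal.div_le_iff (by simpa using hr0) ENNReal.ofReal_ne_top).1 h
  have hsub : f '' {u ∈ Icc (0 : ℝ) 1 | f u ∉ V} ⊆ Vᶜ ∩ Metric.closedBall (y : ℝ) r := by
    rintro _ ⟨u, ⟨hu, huV⟩, rfl⟩
    refine ⟨huV, ?_⟩
    rw [Metric.mem_closedBall, Real.dist_eq, ← hfy]
    have h := hf.distortion u hu _ (T^[n] y).2 1 i1 0 i0
    rw [sub_zero, abs_one, mul_one, ← hd] at h
    refine h.trans ?_
    rw [hr]
    have : |u - (T^[n] y : ℝ)| ≤ 1 := by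
      have := (T^[n] y).2
      rw [abs_le]; constructor <;> linarith [hu.1, hu.2, this.1, this.2]
    have := mul_le_of_le_one_right hd0.le this
    gcongr
  -- Distortion read in the other direction: the inverse of `f` is Lipschitz with constant `exp c /
  -- d`.
  have key := volume_le_of_abs_sub_le (f := f) (C := Real.exp c / d)
    (S := {u ∈ Icc (0 : ℝ) 1 | f u ∉ V}) (by positivity) fun s hs t ht => by
      have h := hf.distortion 1 i1 0 i0 s hs.1 t ht.1
      rw [sub_zero, abs_one, mul_one, ← hd] at h
      rw [div_mul_eq_mul_div, le_div_iff₀ hd0]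
      linarith
  refine key.trans ?_
  calc ENNReal.ofReal (Real.exp c / d) * volume (f '' {u ∈ Icc (0 : ℝ) 1 | f u ∉ V})
      ≤ ENNReal.ofReal (Real.exp c / d) * ENNReal.ofReal (η * (2 * r)) := by
        gcongr
        exact (measure_mono hsub).trans hmeas
    _ = ENNReal.ofReal ε := by
        rw [← ENNReal.ofReal_mul (by positivity)]
        congr 1
        rw [hη, hr]
        field_simp

/-- Two consecutive iterates of a non-null set fill up most of the interval. -/
theorem exists_volume_compl_image_le (hT : IsIntermittentMarkovMap T N a ψ β)
    {W : Set unitInterval} (hW : MeasurableSet W) (h0 : volume W ≠ 0) {ε : ℝ} (hε : 0 < ε) :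
    ∃ n, 1 ≤ n ∧ volume (T^[n] '' W)ᶜ ≤ ENNReal.ofReal ε ∧
      volume (T^[n + 1] '' W)ᶜ ≤ ENNReal.ofReal ε := by
  have hN := hT.one_lt
  obtain ⟨B₀, hB₀⟩ := isCompact_Icc.exists_bound_of_continuousOn
    ((hT.contDiffOn 1 hN).continuousOn_derivWithin_Icc (hT.lt_succ 1 hN))
  set B := max B₀ 1 with hBdef
  have hB1 : 1 ≤ B := le_max_right _ _
  have hB0 : 0 < B := one_pos.trans_le hB1
  have hB : ∀ x ∈ cell a 1, |derivWithin (ψ 1) (cell a 1) x| ≤ B := fun x hx =>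
    (hB₀ x hx).trans (le_max_left _ _)
  obtain ⟨f, n, c, hn, hf, hvol⟩ :=
    hT.exists_isInverseBranch_volume_le hW h0 (div_pos hε hB0)
  set E : Set ℝ := {u ∈ Icc (0 : ℝ) 1 | f u ∉ Subtype.val '' (W ∩ regularSet T a)} with hE
  have himage : ∀ u : unitInterval, (u : ℝ) ∉ E → u ∈ T^[n] '' W := by
    intro u hu
    have : f u ∈ Subtype.val '' (W ∩ regularSet T a) := by
      by_contra h
      exact hu ⟨u.2, h⟩
    obtain ⟨w, hw, e⟩ := this
    exact ⟨w, hw.1, Subtype.ext (hf.iterate_eq w hw.2 u u.2 e.symm)⟩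
  have hεB : ENNReal.ofReal (ε / B) ≤ ENNReal.ofReal ε :=
    ENNReal.ofReal_le_ofReal (div_le_self hε.le hB1)
  refine ⟨n, hn, ?_, ?_⟩
  · rw [unitInterval.volume_apply]
    refine (measure_mono ?_).trans (hvol.trans hεB)
    rintro _ ⟨u, hu, rfl⟩
    by_contra h
    exact hu (himage u h)
  -- A point missed by `T^[n + 1] '' W` has a `ψ 1`-preimage that is either an endpoint or missed by
  -- `T^[n] '' W`, hence in `E`. Applying `ψ 1` costs a factor `B`, whence the choice `ε / B`.
  · set F : Set ℝ := (E ∪ range a) ∩ cell a 1 with hF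
    have hFE : volume F ≤ volume E := by
      refine (measure_mono inter_subset_left).trans ((measure_union_le _ _).trans ?_)
      rw [(countable_range a).measure_zero, add_zero]
    have hsub : Subtype.val '' (T^[n + 1] '' W)ᶜ ⊆ ψ 1 '' F := by
      rintro _ ⟨y, hy, rfl⟩
      have hm := hT.invBranch_mem hN y.2
      refine ⟨invBranch a ψ 1 y, ⟨?_, hm⟩, hT.apply_invBranch hN y.2⟩
      by_contra h
      rw [mem_union, not_or] at h
      obtain ⟨w, hw, e⟩ := himage ⟨_, hT.invBranch_mem_Icc hN y.2⟩ h.1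
      refine hy ⟨w, hw, ?_⟩
      rw [Function.iterate_succ_apply', e]
      exact Subtype.ext (hT.apply_eq_of_invBranch_eq hN
        (fun i hi => h.2 ⟨i, hi.symm⟩) y.2 rfl)
    rw [unitInterval.volume_apply]
    refine (measure_mono hsub).trans ?_
    have hLip := volume_image_le_of_abs_sub_le (f := ψ 1) (S := F) hB0.le fun x hx y hy => by
      obtain ⟨ξ, hξ, e⟩ := (hT.contDiffOn 1 hN).exists_abs_derivWithin_mul_eq hx.2 hy.2
      rw [e]
      exact mul_le_mul_of_nonneg_right (hB ξ hξ) (abs_nonneg _)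
    refine hLip.trans ?_
    calc ENNReal.ofReal B * volume F ≤ ENNReal.ofReal B * ENNReal.ofReal (ε / B) := by
          gcongr
          exact hFE.trans hvol
      _ = ENNReal.ofReal ε := by
          rw [← ENNReal.ofReal_mul hB0.le, mul_div_cancel₀ _ hB0.ne']

/-! ### Conservativity and exactness -/

theorem conservative (hT : IsIntermittentMarkovMap T N a ψ β) : Conservative T volume where
  toQuasiMeasurePreserving := hT.quasiMeasurePreserving
  exists_mem_iterate_mem' W hW h0 := by
    have hpos : 0 < (volume W).toReal := ENNReal.toReal_pos h0 (measure_ne_top _ _)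
    obtain ⟨n, hn, hvol, -⟩ := hT.exists_volume_compl_image_le hW h0 (half_pos hpos)
    by_contra! h
    have hsub : W ⊆ (T^[n] '' W)ᶜ := by
      rintro _ hx ⟨w, hw, rfl⟩
      exact h w hw n (by omega) hx
    have := ENNReal.toReal_le_of_le_ofReal (half_pos hpos).le ((measure_mono hsub).trans hvol)
    linarith

/-- Write `A` as the `T^[n]`-preimage of `B`. Then `T^[n]` sends `A \ T⁻¹ A` into `B`, while `T^[n +
1]` sends it outside `B`; two disjoint sets cannot both miss at most a third of the interval. -/
theorem volume_diff_preimage_eq_zero (hT : IsIntermittentMarkovMap T N a ψ β)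
    {A : Set unitInterval} (hA : MeasurableSet A)
    (htail : ∀ n, MeasurableSet[MeasurableSpace.comap T^[n] inferInstance] A) :
    volume (A \ T ⁻¹' A) = 0 := by
  by_contra h0
  obtain ⟨n, -, h1, h2⟩ := hT.exists_volume_compl_image_le (hA.diff (hT.measurable hA)) h0
    (ε := 1 / 3) (by norm_num)
  have hdisj : T^[n] '' (A \ T ⁻¹' A) ∩ T^[n + 1] '' (A \ T ⁻¹' A) = ∅ := by
    rw [eq_empty_iff_forall_notMem]
    rintro _ ⟨⟨x, hx, rfl⟩, y, hy, e⟩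
    obtain ⟨B, -, hB⟩ := htail n
    rw [Function.iterate_succ_apply] at e
    refine hy.2 ?_
    have hxA := hx.1
    rw [← hB, mem_preimage] at hxA
    rw [mem_preimage, ← hB, mem_preimage, e]
    exact hxA
  have huniv : (univ : Set unitInterval) ⊆
      (T^[n] '' (A \ T ⁻¹' A))ᶜ ∪ (T^[n + 1] '' (A \ T ⁻¹' A))ᶜ := by
    rw [← compl_inter, hdisj, compl_empty]
  have := (measure_mono (μ := volume) huniv).trans ((measure_union_le _ _).trans (add_le_add h1 h2))
  rw [measure_univ, ← ENNReal.ofReal_add (by norm_num) (by norm_num), ENNReal.one_le_ofReal] at this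
  norm_num at this

theorem isExact (hT : IsIntermittentMarkovMap T N a ψ β) : IsExact T volume where
  toQuasiMeasurePreserving := hT.quasiMeasurePreserving
  tail_trivial A hAt := by
    have htail := MeasurableSpace.measurableSet_iInf.1 hAt
    have hA : MeasurableSet A := by
      obtain ⟨B, hB, rfl⟩ := htail 0
      exact hB
    refine or_iff_not_imp_left.2 fun hA0 => ?_
    have hnull := hT.volume_diff_preimage_eq_zero hA htail
    set D := A \ T ⁻¹' A with hD
    have hDm : MeasurableSet D := hA.diff (hT.measurable hA)
    -- `D` is where an orbit can leave `A`; orbits from `A ∩ G` never enter `D`, so they stay in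
    -- `A`.
    set G : Set unitInterval := ⋂ n, T^[n] ⁻¹' Dᶜ with hG
    have hGm : MeasurableSet G :=
      MeasurableSet.iInter fun n => (hT.measurable.iterate n) hDm.compl
    have hGae : volume Gᶜ = 0 := mem_ae_iff.1 <| by
      filter_upwards [hT.ae_forall_iterate_notMem hnull] with x hx
      simpa [hG] using hx
    have hAG : volume (A ∩ G) ≠ 0 := by rwa [measure_inter_conull hGae]
    have hinv : ∀ x ∈ A ∩ G, ∀ n, T^[n] x ∈ A := by
      rintro x ⟨hx, hxG⟩ n
      induction n with
      | zero => exact hx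
      | succ n ih =>
        by_contra h
        rw [Function.iterate_succ_apply'] at h
        exact mem_iInter.1 hxG n ⟨ih, h⟩
    by_contra hc
    have hpos : 0 < (volume Aᶜ).toReal := ENNReal.toReal_pos hc (measure_ne_top _ _)
    obtain ⟨n, -, hvol, -⟩ := hT.exists_volume_compl_image_le (hA.inter hGm) hAG (half_pos hpos)
    have hsub : Aᶜ ⊆ (T^[n] '' (A ∩ G))ᶜ := by
      rintro _ hy ⟨x, hx, rfl⟩
      exact hy (hinv x hx n)
    have := ENNReal.toReal_le_of_le_ofReal (half_pos hpos).le ((measure_mono hsub).trans hvol)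
    linarith

end IsIntermittentMarkovMap

/-- For `μ`, non-singularity comes from invariance. Recurrence and tail triviality are inherited
from `volume`, because its null sets are `μ`-null. -/
theorem theorem1 (T : unitInterval → unitInterval) (N : ℕ∞) (a : ℕ → ℝ) (ψ : ℕ → ℝ → ℝ) (β : ℝ)
    (hT : IsIntermittentMarkovMap T N a ψ β) :
    (Conservative T (volume : Measure unitInterval) ∧
      IsExact T (volume : Measure unitInterval)) ∧
    ∀ μ : Measure unitInterval, SigmaFinite μ → μ ≪ volume → MeasurePreserving T μ μ →
      Conservative T μ ∧ IsExact T μ := by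
  refine ⟨⟨hT.conservative, hT.isExact⟩, fun μ _ hμ hp => ⟨⟨hp.quasiMeasurePreserving, ?_⟩,
    ⟨hp.quasiMeasurePreserving, ?_⟩⟩⟩
  · exact fun W hW h0 => hT.conservative.exists_mem_iterate_mem' hW fun h => h0 (hμ h)
  · exact fun A hA => (hT.isExact.tail_trivial A hA).imp (fun h => hμ h) fun h => hμ h
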